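/- Let $\mathbb{D} = \{z \in \mathbb{C} : |z| < 1\}$. For a real number $a > 0$ let $\mathcal{H}_a$ be the reproducing kernel Hilbert space of functions on $\mathbb{D}$ with reproducing kernel $$k(z,w) = \frac{1}{(1 - z \overline{w})^a} \qquad (z, w \in \mathbb{D}),$$ where the power is defined by the principal branch. For a reproducing kernel Hilbert space $\mathcal{H}$ of complex-valued functions on a set $X$ with kernel $k$, let $\operatorname{Mult}(\mathcal{H})$ be the algebra of all $\varphi : X \to \mathbb{C}$ such that $\varphi f \in \mathcal{H}$ for all $f \in \mathcal{H}$; for such $\varphi$ the operator $M_\varphi : f \mapsto \varphi f$ is bounded on $\mathcal{H}$. For $\Phi = [\varphi_{st}] \in M_r(\operatorname{Mult}(\mathcal{H}))$ let $\|\Phi\|_{M_r(\operatorname{Mult}(\mathcal{H}))}$ be the norm of the operator $[M_{\varphi_{st}}]_{s,t=1}^r$ on the Hilbert space direct sum $\mathcal{H}^r$. The space $\mathcal{H}$ is called a complete Pick space if for all integers $r \ge 1$, all finitely many points $z_1, \dots, z_n \in X$ and all matrices $\Lambda_1, \dots, \Lambda_n \in M_r(\mathbb{C})$ such that the block matrix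 $$\big[ k(z_i, z_j) (I - \Lambda_i \Lambda_j^*) \big]_{i,j=1}^n$$ is positive semi-definite, there exists $\Phi \in M_r(\operatorname{Mult}(\mathcal{H}))$ with $\Phi(z_i) = \Lambda_i$ for $1 \le i \le n$ and $\|\Phi\|_{M_r(\operatorname{Mult}(\mathcal{H}))} \le 1$. Then, for every $a > 0$, the space $\mathcal{H}_a$ is a complete Pick space if and only if $0 < a \le 1$. -/

import Mathlib

open scoped ComplexConjugate ComplexOrder Complex.UnitDisc

noncomputable section

namespace CompletePick

section General

variable {X : Type*} (H : Type*) [NormedAddCommGroup H] [InnerProductSpace ℂ H]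
  [RKHS ℂ H X ℂ]

/-- The multiplier algebra of a reproducing kernel Hilbert space `H` of complex-valued functions
on `X`: all functions `φ : X → ℂ` such that `φ · f ∈ H` whenever `f ∈ H`. -/
def multiplierAlgebra : Subalgebra ℂ (X → ℂ) where
  carrier := {φ | ∀ f : H, ∃ g : H, ∀ x, g x = φ x * f x}
  mul_mem' := by
    intro φ ψ hφ hψ f
    obtain ⟨g, hg⟩ := hψ f
    obtain ⟨g', hg'⟩ := hφ g
    exact ⟨g', fun x => by rw [hg', hg, Pi.mul_apply, mul_assoc]⟩
  add_mem' := by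
    intro φ ψ hφ hψ f
    obtain ⟨g, hg⟩ := hφ f
    obtain ⟨g', hg'⟩ := hψ f
    exact ⟨g + g', fun x => by
      rw [RKHS.coe_add, Pi.add_apply, hg', hg, Pi.add_apply, add_mul]⟩
  algebraMap_mem' := by
    intro c f
    exact ⟨c • f, fun x => by rw [RKHS.coe_smul]; simp⟩

variable {H}

/-- The multiplication operator `f ↦ φ · f` on `H` as a linear map. -/
def mulLinearMap (φ : multiplierAlgebra (X := X) H) : H →ₗ[ℂ] H where
  toFun f := (φ.2 f).choose
  map_add' f g := by
    ext x
    rw [(φ.2 (f + g)).choose_spec, RKHS.coe_add, RKHS.coe_add, Pi.add_apply, Pi.add_apply,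
      (φ.2 f).choose_spec, (φ.2 g).choose_spec, mul_add]
  map_smul' c f := by
    ext x
    rw [(φ.2 (c • f)).choose_spec, RKHS.coe_smul, RingHom.id_apply, RKHS.coe_smul,
      Pi.smul_apply, Pi.smul_apply, (φ.2 f).choose_spec, smul_eq_mul, smul_eq_mul]
    ring

theorem mulLinearMap_apply (φ : multiplierAlgebra (X := X) H) (f : H) (x : X) :
    mulLinearMap φ f x = (φ : X → ℂ) x * f x :=
  (φ.2 f).choose_spec x

variable [CompleteSpace H]

/-- The multiplication operator `M_φ : f ↦ φ · f`, which is bounded on `H` by the closed graph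
theorem. -/
def mulOp (φ : multiplierAlgebra (X := X) H) : H →L[ℂ] H :=
  ContinuousLinearMap.ofSeqClosedGraph (g := mulLinearMap φ) <| by
    intro u f g hu hg
    ext x
    have h1 := ((RKHS.continuous_eval (𝕜 := ℂ) (H := H) x).tendsto g).comp hg
    have h2 := (((RKHS.continuous_eval (𝕜 := ℂ) (H := H) x).tendsto f).comp hu).const_mul
      ((φ : X → ℂ) x)
    rw [mulLinearMap_apply]
    refine tendsto_nhds_unique h1 (h2.congr fun n => ?_)
    simp only [Function.comp_apply, mulLinearMap_apply]

theorem mulOp_apply (φ : multiplierAlgebra (X := X) H) (f : H) (x : X) :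
    mulOp φ f x = (φ : X → ℂ) x * f x :=
  mulLinearMap_apply φ f x

/-- The operator `[M_{Φ_ij}]` on the `r`-fold Hilbert space direct sum `H ⊕ ⋯ ⊕ H` given by a
matrix `Φ` of multipliers. Its operator norm is the norm of `Φ` in `M_r(Mult(H))`. -/
def matrixMulOp {r : ℕ} (Φ : Matrix (Fin r) (Fin r) (multiplierAlgebra (X := X) H)) :
    PiLp 2 (fun _ : Fin r => H) →L[ℂ] PiLp 2 (fun _ : Fin r => H) :=
  ((PiLp.continuousLinearEquiv 2 ℂ (fun _ : Fin r => H)).symm :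
      (Fin r → H) →L[ℂ] PiLp 2 (fun _ : Fin r => H)) ∘L
    ContinuousLinearMap.pi fun i =>
      ∑ j, mulOp (Φ i j) ∘L PiLp.proj 2 (fun _ : Fin r => H) j

theorem matrixMulOp_apply {r : ℕ} (Φ : Matrix (Fin r) (Fin r) (multiplierAlgebra (X := X) H))
    (f : PiLp 2 (fun _ : Fin r => H)) (i : Fin r) :
    matrixMulOp Φ f i = ∑ j, mulOp (Φ i j) (f j) := by
  simp [matrixMulOp]

/-- The block matrix `[k(z_i, z_j) (I - Λ_i Λ_j^*)]_{i,j}` with rows and columns indexed by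
`{1, …, n} × {1, …, r}`, where `k` is the reproducing kernel of `H`. -/
def pickMatrix (H : Type*) [NormedAddCommGroup H] [InnerProductSpace ℂ H] [CompleteSpace H]
    [RKHS ℂ H X ℂ] {n r : ℕ} (z : Fin n → X) (Λ : Fin n → Matrix (Fin r) (Fin r) ℂ) :
    Matrix (Fin n × Fin r) (Fin n × Fin r) ℂ :=
  Matrix.of fun p q =>
    RKHS.kernel H (z p.1) (z q.1) 1 * (1 - Λ p.1 * (Λ q.1).conjTranspose) p.2 q.2

/-- Complete Pick spaces: every matrix-valued interpolation problem `z_i ↦ Λ_i` whose Pick matrix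
is positive semi-definite is solved by a matrix `Φ` of multipliers of norm at most one. -/
def IsCompletePickSpace (H : Type*) [NormedAddCommGroup H] [InnerProductSpace ℂ H]
    [CompleteSpace H] [RKHS ℂ H X ℂ] : Prop :=
  ∀ r : ℕ, 1 ≤ r → ∀ (n : ℕ) (z : Fin n → X) (Λ : Fin n → Matrix (Fin r) (Fin r) ℂ),
    (pickMatrix H z Λ).PosSemidef →
      ∃ Φ : Matrix (Fin r) (Fin r) (multiplierAlgebra (X := X) H),
        (∀ i, (Φ.map fun φ => (φ : X → ℂ) (z i)) = Λ i) ∧ ‖matrixMulOp Φ‖ ≤ 1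

end General

section Disc

/-- The kernel `(z, w) ↦ 1 / (1 - z w̄)^a` on the unit disc (principal branch), where a complex
number is regarded as the operator on `ℂ` that multiplies by it. -/
def discKernel (a : ℝ) : Matrix 𝔻 𝔻 (ℂ →L[ℂ] ℂ) :=
  Matrix.of fun z w =>
    (1 / (1 - (z : ℂ) * conj (w : ℂ)) ^ (a : ℂ)) • ContinuousLinearMap.id ℂ ℂ

theorem choose_nonneg {a : ℝ} (ha : 0 < a) (n : ℕ) : 0 ≤ Ring.choose (a + n - 1) n := by
  have h := Ring.descPochhammer_eq_factorial_smul_choose (a + n - 1) n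
  rw [Polynomial.descPochhammer_smeval_eq_ascPochhammer, Polynomial.ascPochhammer_smeval_cast,
    Polynomial.ascPochhammer_smeval_eq_eval] at h
  have h2 : a + n - 1 - n + 1 = a := by ring
  rw [h2] at h
  have h3 := ascPochhammer_pos n a ha
  rw [h, nsmul_eq_mul] at h3
  exact (pos_of_mul_pos_right h3 (by positivity)).le

theorem hasSum_kernel (a : ℝ) (z w : 𝔻) :
    HasSum (fun n : ℕ => ((Ring.choose (a + n - 1) n : ℝ) : ℂ) * ((z : ℂ) * conj (w : ℂ)) ^ n)
      (1 / (1 - (z : ℂ) * conj (w : ℂ)) ^ (a : ℂ)) := by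
  have hlt : ‖(z : ℂ) * conj (w : ℂ)‖ < 1 := by
    rw [norm_mul, RCLike.norm_conj]
    exact mul_lt_one_of_nonneg_of_lt_one_left (norm_nonneg _) z.norm_lt_one w.norm_lt_one.le
  have h := (Complex.one_div_one_sub_cpow_hasFPowerSeriesOnBall_zero (a : ℂ)).hasSum
    (y := (z : ℂ) * conj (w : ℂ)) (by
      rw [← ENNReal.ofReal_one, Metric.eball_ofReal]
      simpa using hlt)
  rw [zero_add] at h
  refine h.congr_fun ?_
  intro n
  rw [Complex.ofReal_choose]
  simp [FormalMultilinearSeries.ofScalars]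

theorem kernel_sum_nonneg {a : ℝ} (ha : 0 < a) (v : 𝔻 →₀ ℂ) :
    0 ≤ (∑ z ∈ v.support, ∑ w ∈ v.support,
      (1 / (1 - (w : ℂ) * conj (z : ℂ)) ^ (a : ℂ)) * v z * conj (v w)).re := by
  have h : HasSum (fun n : ℕ => ∑ z ∈ v.support, ∑ w ∈ v.support,
      ((Ring.choose (a + n - 1) n : ℝ) : ℂ) * ((w : ℂ) * conj (z : ℂ)) ^ n * v z * conj (v w))
      (∑ z ∈ v.support, ∑ w ∈ v.support,
        (1 / (1 - (w : ℂ) * conj (z : ℂ)) ^ (a : ℂ)) * v z * conj (v w)) :=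
    hasSum_sum fun z _ => hasSum_sum fun w _ =>
      ((hasSum_kernel a w z).mul_right _).mul_right _
  refine (Complex.hasSum_re h).nonneg fun n => ?_
  have h2 : (∑ z ∈ v.support, ∑ w ∈ v.support,
      ((Ring.choose (a + n - 1) n : ℝ) : ℂ) * ((w : ℂ) * conj (z : ℂ)) ^ n * v z * conj (v w))
      = ((Ring.choose (a + n - 1) n *
        Complex.normSq (∑ z ∈ v.support, conj (z : ℂ) ^ n * v z) : ℝ) : ℂ) := by
    rw [Complex.ofReal_mul, ← Complex.mul_conj, map_sum, Finset.sum_mul_sum, Finset.mul_sum]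
    refine Finset.sum_congr rfl fun z _ => ?_
    rw [Finset.mul_sum]
    refine Finset.sum_congr rfl fun w _ => ?_
    simp only [map_mul, map_pow, Complex.conj_conj]
    ring
  rw [h2, Complex.ofReal_re]
  exact mul_nonneg (choose_nonneg ha n) (Complex.normSq_nonneg _)

theorem discKernel_isHermitian (a : ℝ) : (discKernel a).IsHermitian := by
  ext z w
  have h1 := hasSum_kernel a w z
  have h2 := (hasSum_kernel a z w).unique (f := _) <| by
    have h3 := Complex.hasSum_conj'.mpr h1
    refine h3.congr_fun fun n => ?_
    simp [mul_comm]
  have h3 : star (ContinuousLinearMap.id ℂ ℂ) = ContinuousLinearMap.id ℂ ℂ :=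
    star_one (ℂ →L[ℂ] ℂ)
  simp only [Matrix.conjTranspose_apply, discKernel, Matrix.of_apply, star_smul, h2, h3]
  rfl

theorem discKernel_posSemidef {a : ℝ} (ha : 0 < a) : (discKernel a).PosSemidef := by
  have key := (RKHS.posSemidef_tfae (K := discKernel a)).out 0 2
  refine key.mpr ⟨discKernel_isHermitian a, fun v => ?_⟩
  have h := kernel_sum_nonneg ha v
  have h2 : (v.sum fun z c => v.sum fun w d => inner ℂ (discKernel a w z c) d) =
      ∑ z ∈ v.support, ∑ w ∈ v.support,
        conj ((1 / (1 - (w : ℂ) * conj (z : ℂ)) ^ (a : ℂ)) * v z * conj (v w)) := by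
    simp only [Finsupp.sum, discKernel, Matrix.of_apply]
    refine Finset.sum_congr rfl fun z _ => Finset.sum_congr rfl fun w _ => ?_
    simp [mul_comm]
  rw [h2]
  simp only [← map_sum]
  rw [RCLike.conj_re]
  exact h

/-- The space `H_a` for `a > 0`: the reproducing kernel Hilbert space on the unit disc with
reproducing kernel `1 / (1 - z w̄)^a`. -/
abbrev WeightedSpace (a : ℝ) (ha : 0 < a) : Type :=
  haveI : Fact (discKernel a).PosSemidef := ⟨discKernel_posSemidef ha⟩
  RKHS.OfKernel (discKernel a)

theorem kernel_weightedSpace (a : ℝ) (ha : 0 < a) (z w : 𝔻) :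
    RKHS.kernel (WeightedSpace a ha) z w 1 = 1 / (1 - (z : ℂ) * conj (w : ℂ)) ^ (a : ℂ) := by
  haveI : Fact (discKernel a).PosSemidef := ⟨discKernel_posSemidef ha⟩
  have h := congrArg (fun T : ℂ →L[ℂ] ℂ => T 1)
    (congrFun (congrFun (RKHS.OfKernel.kernel_ofKernel (K := discKernel a)) z) w)
  refine h.trans ?_
  simp [discKernel]

end Disc

end CompletePick

end

open scoped InnerProductSpace

noncomputable section

namespace CompletePick

/-! ### Gram matrices, contractions and elementary tensors. -/

section Hilbert

variable {ι U W : Type*} [NormedAddCommGroup U] [InnerProductSpace ℂ U]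
  [NormedAddCommGroup W] [InnerProductSpace ℂ W]

/-! For `0 < a ≤ 1`, all power series coefficients of `1 - (1 - x)^a` are nonnegative, so `1 -
1/k(z,w) = ⟨b z, b w⟩` for a map `b` into `ℓ²`. Any kernel of this form is complete Pick
(`isCompletePickSpace_of_kernel`), by a lurking isometry argument. Factoring the Pick matrix as a
Gram matrix of vectors `γ₀` turns the data into an equality of Gram matrices, which yields a
contraction `V` sending `(e, γ₀ ⊗ b)` to `(ψ₀, γ₀)` at the nodes. At every other point the equation
`γ = snd V (e, γ ⊗ b)` has a unique solution because `‖b‖ < 1`, and the first component of `V` then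
defines the interpolant. Contractivity of `V` makes `k (I - Φ Φ^*)` a positive kernel, so that `Φ`
is a contractive multiplier.

For `a > 1`, a two-point scalar problem has a positive Pick matrix but violates the Schwarz lemma,
which contractive multipliers vanishing at `0` obey since they are holomorphic and bounded by one.
-/

theorem finsupp_sum_gram (u : ι → U) (c : ι →₀ ℂ) :
    (c.sum fun i x => c.sum fun j y => star x * Matrix.gram ℂ u i j * y) =
      ((‖Finsupp.linearCombination ℂ u c‖ ^ 2 : ℝ) : ℂ) := by
  have h := inner_self_eq_norm_sq_to_K (𝕜 := ℂ) (Finsupp.linearCombination ℂ u c)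
  refine Eq.trans ?_ (h.trans (Complex.ofReal_pow _ _).symm)
  rw [Finsupp.linearCombination_apply, Finsupp.sum_comm]
  simp only [Finsupp.sum, sum_inner, inner_sum, inner_smul_left, inner_smul_right,
    Matrix.gram_apply, Finset.mul_sum]
  refine Finset.sum_congr rfl fun i _ => Finset.sum_congr rfl fun j _ => ?_
  simp only [RCLike.star_def]
  ring

/-- A family whose Gram matrix is dominated by that of another family is its image under a
contraction. -/
theorem exists_contraction_of_gram_le [CompleteSpace U] [CompleteSpace W] (u : ι → U) (v : ι → W)
    (h : (Matrix.gram ℂ u - Matrix.gram ℂ v).PosSemidef) :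
    ∃ T : U →L[ℂ] W, ‖T‖ ≤ 1 ∧ ∀ i, T (u i) = v i := by
  have hle : ∀ c : ι →₀ ℂ,
      ‖Finsupp.linearCombination ℂ v c‖ ≤ ‖Finsupp.linearCombination ℂ u c‖ := by
    intro c
    have h1 := h.2 c
    simp only [Matrix.sub_apply, mul_sub, sub_mul, Finsupp.sum_sub] at h1
    rw [finsupp_sum_gram, finsupp_sum_gram, ← Complex.ofReal_sub, Complex.zero_le_real] at h1
    exact le_of_sq_le_sq (sub_nonneg.mp h1) (norm_nonneg _)
  let S := (LinearMap.range (Finsupp.linearCombination ℂ u)).topologicalClosure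
  have hmem : ∀ c, Finsupp.linearCombination ℂ u c ∈ S := fun c =>
    Submodule.le_topologicalClosure _ (LinearMap.mem_range_self _ c)
  let e : (ι →₀ ℂ) →ₗ[ℂ] S := (Finsupp.linearCombination ℂ u).codRestrict S hmem
  have hdense : DenseRange e := by
    rw [DenseRange, Subtype.dense_iff]
    intro x hx
    refine closure_mono ?_ hx
    rintro _ ⟨c, rfl⟩
    exact ⟨e c, ⟨c, rfl⟩, rfl⟩
  have hnorm : ∀ c, ‖Finsupp.linearCombination ℂ v c‖ ≤ 1 * ‖e c‖ := fun c => by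
    rw [one_mul]; exact hle c
  have : CompleteSpace S := (Submodule.isClosed_topologicalClosure _).completeSpace_coe
  let T := (Finsupp.linearCombination ℂ v).extendOfNorm e
  -- The map `u i ↦ v i` is extended by continuity to the closed span, and by zero on its orthogonal
  -- complement.
  refine ⟨T ∘L S.orthogonalProjectionOnto, ?_, fun i => ?_⟩
  · refine (ContinuousLinearMap.opNorm_comp_le _ _).trans ?_
    exact mul_le_one₀ (LinearMap.opNorm_extendOfNorm_le hdense zero_le_one hnorm) (norm_nonneg _)
      (Submodule.orthogonalProjectionOnto_norm_le _)
  · have h1 : u i = (e (Finsupp.single i 1) : U) := by simp [e]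
    rw [ContinuousLinearMap.comp_apply, h1,
      Submodule.orthogonalProjectionOnto_mem_subspace_eq_self,
      LinearMap.extendOfNorm_eq hdense ⟨1, hnorm⟩]
    simp

theorem gram_posSemidef (u : ι → U) : (Matrix.gram ℂ u).PosSemidef := by
  refine ⟨Matrix.isHermitian_gram ℂ u, fun c => ?_⟩
  rw [finsupp_sum_gram, Complex.zero_le_real]
  positivity

theorem gram_sub_gram_comp_posSemidef (V : U →L[ℂ] W) (hV : ‖V‖ ≤ 1) (u : ι → U) :
    (Matrix.gram ℂ u - Matrix.gram ℂ (V ∘ u)).PosSemidef := by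
  have h1 := Matrix.posSemidef_opNorm_smul_gram_sub_gram u V (𝕜 := ℂ)
  have h2 : (0 : ℝ) ≤ 1 - ‖V‖ ^ 2 := by nlinarith [norm_nonneg V]
  have h3 := ((gram_posSemidef u).smul h2).add h1
  convert! h3 using 1
  rw [sub_smul, one_smul]
  abel

/-- The elementary tensor `x ⊗ h` in the Hilbert space `ℂ^ι ⊗ U`, realised as a direct sum. -/
def tensor {ι : Type*} (x : EuclideanSpace ℂ ι) (h : U) : PiLp 2 fun _ : ι => U :=
  WithLp.toLp 2 fun i => x i • h

theorem tensor_apply {ι : Type*} (x : EuclideanSpace ℂ ι) (h : U) (i : ι) :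
    tensor x h i = x i • h := rfl

theorem tensor_add {ι : Type*} (x y : EuclideanSpace ℂ ι) (h : U) :
    tensor (x + y) h = tensor x h + tensor y h := by
  ext i
  simp [tensor_apply, add_smul]

theorem tensor_sub {ι : Type*} (x y : EuclideanSpace ℂ ι) (h : U) :
    tensor (x - y) h = tensor x h - tensor y h := by
  ext i
  simp [tensor_apply, sub_smul]

theorem tensor_smul {ι : Type*} (c : ℂ) (x : EuclideanSpace ℂ ι) (h : U) :
    tensor (c • x) h = c • tensor x h := by
  ext i
  simp [tensor_apply, mul_smul]

theorem inner_tensor {ι : Type*} [Fintype ι] (x y : EuclideanSpace ℂ ι) (h k : U) :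
    ⟪tensor x h, tensor y k⟫_ℂ = ⟪h, k⟫_ℂ * ⟪x, y⟫_ℂ := by
  simp only [PiLp.inner_apply, tensor_apply, inner_smul_left, inner_smul_right, Finset.mul_sum,
    RCLike.inner_apply]
  refine Finset.sum_congr rfl fun i _ => ?_
  ring

theorem norm_tensor {ι : Type*} [Fintype ι] (x : EuclideanSpace ℂ ι) (h : U) :
    ‖tensor x h‖ = ‖h‖ * ‖x‖ := by
  have h1 := inner_tensor x x h h
  rw [inner_self_eq_norm_sq_to_K, inner_self_eq_norm_sq_to_K, inner_self_eq_norm_sq_to_K] at h1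
  rw [← mul_pow] at h1
  have h2 : ‖tensor x h‖ ^ 2 = (‖h‖ * ‖x‖) ^ 2 := by exact_mod_cast h1
  exact (sq_eq_sq₀ (norm_nonneg _) (by positivity)).mp h2

variable {κ : Type*} [Fintype κ]
variable {E : Type*} [NormedAddCommGroup E] [InnerProductSpace ℂ E]

/-- The map `x ↦ snd V (0, x ⊗ b)` has norm at most `‖b‖ < 1`, so it fixes only `0`. -/
theorem eq_zero_of_eq_snd_contraction
    (V : WithLp 2 (E × PiLp 2 fun _ : κ => U) →L[ℂ] WithLp 2 (E × EuclideanSpace ℂ κ))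
    (hV : ‖V‖ ≤ 1) {b : U} (hb : ‖b‖ < 1) (x : EuclideanSpace ℂ κ)
    (hx : x = (V (WithLp.toLp 2 (0, tensor x b))).snd) : x = 0 := by
  have h1 : ‖(V (WithLp.toLp 2 ((0 : E), tensor x b))).snd‖ ≤ ‖b‖ * ‖x‖ := by
    refine (WithLp.norm_snd_le _ _).trans ?_
    refine (V.le_of_opNorm_le hV _).trans ?_
    rw [one_mul, WithLp.norm_toLp_snd, norm_tensor]
  rw [← hx] at h1
  by_contra hne
  nlinarith [norm_pos_iff.mpr hne]

/-- The equation is affine in `x`, and its linear part is injective, hence surjective since `κ` is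
finite. -/
theorem exists_eq_snd_contraction
    (V : WithLp 2 (E × PiLp 2 fun _ : κ => U) →L[ℂ] WithLp 2 (E × EuclideanSpace ℂ κ))
    (hV : ‖V‖ ≤ 1) {b : U} (hb : ‖b‖ < 1) (e : E) :
    ∃ x : EuclideanSpace ℂ κ, x = (V (WithLp.toLp 2 (e, tensor x b))).snd := by
  let L : EuclideanSpace ℂ κ →ₗ[ℂ] EuclideanSpace ℂ κ :=
    { toFun := fun x => x - (V (WithLp.toLp 2 ((0 : E), tensor x b))).snd
      map_add' := fun x y => by
        have : WithLp.toLp 2 ((0 : E), tensor (x + y) b) =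
            WithLp.toLp 2 ((0 : E), tensor x b) + WithLp.toLp 2 ((0 : E), tensor y b) := 
          (congrArg (WithLp.toLp 2) (by rw [tensor_add, Prod.mk_add_mk, add_zero])).trans
            (WithLp.toLp_add 2 _ _)
        rw [this, map_add, WithLp.add_snd]
        abel
      map_smul' := fun c x => by
        have : WithLp.toLp 2 ((0 : E), tensor (c • x) b) =
            c • WithLp.toLp 2 ((0 : E), tensor x b) := 
          (congrArg (WithLp.toLp 2) (by rw [tensor_smul, Prod.smul_mk, smul_zero])).trans
            (WithLp.toLp_smul 2 _ _)
        rw [this, map_smul, WithLp.smul_snd, RingHom.id_apply, smul_sub] }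
  have hinj : Function.Injective L := by
    rw [injective_iff_map_eq_zero]
    exact fun x hx => eq_zero_of_eq_snd_contraction V hV hb x (sub_eq_zero.mp hx)
  obtain ⟨x, hx⟩ := LinearMap.injective_iff_surjective.mp hinj
    (V (WithLp.toLp 2 (e, (0 : PiLp 2 fun _ : κ => U)))).snd
  refine ⟨x, ?_⟩
  have h1 : WithLp.toLp 2 (e, tensor x b) =
      WithLp.toLp 2 (e, (0 : PiLp 2 fun _ : κ => U)) + WithLp.toLp 2 ((0 : E), tensor x b) := by
    rw [← WithLp.toLp_add, Prod.mk_add_mk, add_zero, zero_add]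
  rw [h1, map_add, WithLp.add_snd, ← hx]
  exact (sub_add_cancel _ _).symm

theorem eq_of_eq_snd_contraction
    (V : WithLp 2 (E × PiLp 2 fun _ : κ => U) →L[ℂ] WithLp 2 (E × EuclideanSpace ℂ κ))
    (hV : ‖V‖ ≤ 1) {b : U} (hb : ‖b‖ < 1) {e : E} {x y : EuclideanSpace ℂ κ}
    (hx : x = (V (WithLp.toLp 2 (e, tensor x b))).snd)
    (hy : y = (V (WithLp.toLp 2 (e, tensor y b))).snd) : x = y := by
  rw [← sub_eq_zero]
  refine eq_zero_of_eq_snd_contraction V hV hb _ ?_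
  have h1 : WithLp.toLp 2 ((0 : E), tensor (x - y) b) =
      WithLp.toLp 2 (e, tensor x b) - WithLp.toLp 2 (e, tensor y b) := 
    (congrArg (WithLp.toLp 2) (by rw [tensor_sub, Prod.mk_sub_mk, sub_self])).trans
      (WithLp.toLp_sub 2 _ _)
  rw [h1, map_sub, WithLp.sub_snd, ← hx, ← hy]

end Hilbert

/-! ### Contractive multipliers and the lurking isometry. -/

section Realization

open scoped Matrix MatrixOrder Matrix.Norms.L2Operator

variable {X H : Type*} [NormedAddCommGroup H] [InnerProductSpace ℂ H] [CompleteSpace H]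
  [RKHS ℂ H X ℂ]

theorem inner_kerFun_kerFun (x y : X) :
    ⟪RKHS.kerFun H x 1, RKHS.kerFun H y 1⟫_ℂ = RKHS.kernel H x y 1 := by
  rw [RKHS.kerFun_inner, RKHS.kerFun_apply]
  simp

/-- The functions with values `ψ z t` determine, through `Φ_{ts}(z) = conj (ψ z t s)`, a matrix of
multipliers of norm at most one as soon as the kernel `k(z, w) (I - Φ(z) Φ(w)^*)` is positive. -/
theorem exists_matrixMulOp_norm_le {r : ℕ} (ψ : X × Fin r → EuclideanSpace ℂ (Fin r))
    (hψ : (Matrix.gram ℂ (fun p : X × Fin r =>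
        tensor (EuclideanSpace.single p.2 (1 : ℂ)) (RKHS.kerFun H p.1 1)) -
      Matrix.gram ℂ (fun p : X × Fin r => tensor (ψ p) (RKHS.kerFun H p.1 1))).PosSemidef) :
    ∃ Φ : Matrix (Fin r) (Fin r) (multiplierAlgebra (X := X) H),
      (∀ x t s, (Φ t s : X → ℂ) x = conj (ψ (x, t) s)) ∧ ‖matrixMulOp Φ‖ ≤ 1 := by
  obtain ⟨T, hT, hTu⟩ := exists_contraction_of_gram_le _ _ hψ
  let S := ContinuousLinearMap.adjoint T
  -- Pairing with `e_t ⊗ k_x` evaluates component `t` at `x`; the adjoint is therefore a matrix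
  -- multiplication operator.
  have hS : ∀ f t x, S f t x = ∑ s, conj (ψ (x, t) s) * f s x := by
    intro f t x
    have h1 := ContinuousLinearMap.adjoint_inner_right T
      (tensor (EuclideanSpace.single t (1 : ℂ)) (RKHS.kerFun H x 1)) f
    rw [hTu (x, t), PiLp.inner_apply, PiLp.inner_apply] at h1
    simp only [tensor_apply, inner_smul_left, RKHS.kerFun_inner] at h1
    rw [Finset.sum_eq_single t (fun s _ hs => by simp [hs]) (by simp)] at h1
    simpa using h1
  have hmem : ∀ t s, (fun x => conj (ψ (x, t) s)) ∈ multiplierAlgebra (X := X) H := by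
    intro t s f
    refine ⟨S (PiLp.single 2 s f) t, fun x => ?_⟩
    rw [hS, Finset.sum_eq_single s (fun s' _ hs => by simp [hs]) (by simp)]
    simp
  refine ⟨Matrix.of fun t s => ⟨_, hmem t s⟩, fun x t s => rfl, ?_⟩
  have h2 : matrixMulOp (Matrix.of fun t s => ⟨_, hmem t s⟩) = S := by
    ext f t x
    rw [matrixMulOp_apply, hS]
    have h3 : ∀ g : Fin r → H, (∑ s, g s) x = ∑ s, g s x := fun g => by
      simp only [← RKHS.coeCLM_apply, map_sum, Finset.sum_apply]
    rw [h3]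
    exact Finset.sum_congr rfl fun s _ => mulOp_apply _ _ _
  rw [h2, LinearIsometryEquiv.norm_map]
  exact hT

/-- A reproducing kernel Hilbert space whose kernel has the form `1 / (1 - ⟨b z, b w⟩)` is a
complete Pick space. -/
theorem isCompletePickSpace_of_kernel {M : Type*} [NormedAddCommGroup M] [InnerProductSpace ℂ M]
    [CompleteSpace M] (b : X → M)
    (hb : ∀ x y, RKHS.kernel H x y 1 * (1 - ⟪b x, b y⟫_ℂ) = 1) : IsCompletePickSpace H := by
  intro r _ n z Λ hP
  -- On the diagonal, `‖k_x‖² (1 - ‖b x‖²) = 1`.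
  have hbn : ∀ x, ‖b x‖ < 1 := by
    intro x
    have h1 := hb x x
    rw [← inner_kerFun_kerFun, inner_self_eq_norm_sq_to_K, inner_self_eq_norm_sq_to_K] at h1
    have h2 : ‖RKHS.kerFun H x 1‖ ^ 2 * (1 - ‖b x‖ ^ 2) = 1 := by
      apply Complex.ofReal_injective
      push_cast
      exact h1
    by_contra! h3
    have h4 : 0 ≤ ‖b x‖ ^ 2 - 1 := by nlinarith
    nlinarith [mul_nonneg (sq_nonneg ‖RKHS.kerFun H x 1‖) h4]
  obtain ⟨A, hA⟩ : ∃ A : Matrix (Fin n × Fin r) (Fin n × Fin r) ℂ, pickMatrix H z Λ = Aᴴ * A := by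
    exact CStarAlgebra.nonneg_iff_eq_star_mul_self.mp hP.nonneg
  let e : Fin r → EuclideanSpace ℂ (Fin r) := fun t => EuclideanSpace.single t 1
  let γ₀ : Fin n × Fin r → EuclideanSpace ℂ (Fin n × Fin r) :=
    fun p => WithLp.toLp 2 fun q => A q p
  let ψ₀ : Fin n × Fin r → EuclideanSpace ℂ (Fin r) :=
    fun p => WithLp.toLp 2 fun s => conj (Λ p.1 p.2 s)
  have he : ∀ t t', ⟪e t, e t'⟫_ℂ = (1 : Matrix (Fin r) (Fin r) ℂ) t t' := by
    intro t t'
    simp [e, Matrix.one_apply, EuclideanSpace.inner_single_left]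
  have hγ₀ : ∀ p q, ⟪γ₀ p, γ₀ q⟫_ℂ = pickMatrix H z Λ p q := by
    intro p q
    simp [hA, γ₀, PiLp.inner_apply, Matrix.mul_apply, mul_comm]
  have hψ₀ : ∀ p q, ⟪ψ₀ p, ψ₀ q⟫_ℂ = (Λ p.1 * (Λ q.1)ᴴ) p.2 q.2 := by
    intro p q
    simp [ψ₀, PiLp.inner_apply, Matrix.mul_apply, mul_comm]
  -- Multiplying the Pick matrix entrywise by `1 - ⟨b, b⟩` gives `I - Λ Λ^*`; rearranged, this says
  -- that the two families have equal Gram matrices.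
  obtain ⟨V, hV, hVu⟩ := exists_contraction_of_gram_le
    (fun p => WithLp.toLp 2 (e p.2, tensor (γ₀ p) (b (z p.1))))
    (fun p => WithLp.toLp 2 (ψ₀ p, γ₀ p)) (by
      convert! Matrix.PosSemidef.zero using 1
      ext p q
      simp only [Matrix.sub_apply, Matrix.gram_apply, WithLp.prod_inner_apply, inner_tensor, he,
        hγ₀, hψ₀, Matrix.zero_apply]
      simp only [pickMatrix, Matrix.of_apply, Matrix.sub_apply]
      linear_combination
        -((1 : Matrix (Fin r) (Fin r) ℂ) p.2 q.2 - (Λ p.1 * (Λ q.1)ᴴ) p.2 q.2) *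
          hb (z p.1) (z q.1))
  choose γ hγ using fun p : X × Fin r => exists_eq_snd_contraction V hV (hbn p.1) (e p.2)
  let u : X × Fin r → _ := fun p => WithLp.toLp 2 (e p.2, tensor (γ p) (b p.1))
  let ψ : X × Fin r → EuclideanSpace ℂ (Fin r) := fun p => (V (u p)).fst
  obtain ⟨Φ, hΦ, hnorm⟩ := exists_matrixMulOp_norm_le (H := H) ψ (by
    -- By the Schur product theorem `k · (Gram u - Gram (V u))` is positive. Since `k (1 - ⟨b, b⟩) =
    -- 1`, it equals `k (I - Φ Φ^*) - Gram γ`.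
    have h1 := (gram_posSemidef fun p : X × Fin r => RKHS.kerFun H p.1 1).hadamard
      (gram_sub_gram_comp_posSemidef V hV u)
    convert! h1.add (gram_posSemidef γ) using 1
    ext p q
    have h2 : ⟪V (u p), V (u q)⟫_ℂ = ⟪ψ p, ψ q⟫_ℂ + ⟪γ p, γ q⟫_ℂ := by
      rw [WithLp.prod_inner_apply]
      congr 2
      · exact (hγ p).symm
      · exact (hγ q).symm
    simp only [Matrix.sub_apply, Matrix.add_apply, Matrix.hadamard_apply, Matrix.gram_apply,
      Function.comp_apply, h2, inner_tensor, inner_kerFun_kerFun]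
    simp only [u, WithLp.prod_inner_apply, inner_tensor]
    linear_combination ⟪γ p, γ q⟫_ℂ * hb p.1 q.1)
  refine ⟨Φ, fun i => ?_, hnorm⟩
  ext t s
  -- At a node `γ₀` solves the equation defining `γ`, so uniqueness gives the interpolation.
  have h1 : γ (z i, t) = γ₀ (i, t) :=
    eq_of_eq_snd_contraction V hV (hbn (z i)) (hγ (z i, t)) (by
      have := congrArg WithLp.snd (hVu (i, t))
      exact this.symm)
  have h2 : ψ (z i, t) = ψ₀ (i, t) := by
    simp only [ψ, u, h1]
    exact congrArg WithLp.fst (hVu (i, t))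
  rw [Matrix.map_apply, hΦ, h2]
  simp [ψ₀]

end Realization

/-! ### The case `a ≤ 1`: signs of the binomial coefficients. -/

section Sufficiency

/-- Up to `(n + 1)!` this is `(-a)(1 - a)⋯(n - a)`, whose only negative factor is the first. -/
theorem choose_succ_nonpos {a : ℝ} (ha : 0 < a) (ha1 : a ≤ 1) (n : ℕ) :
    Ring.choose (-a + (n + 1 : ℕ) - 1) (n + 1) ≤ 0 := by
  have h := Ring.descPochhammer_eq_factorial_smul_choose (-a + (n + 1 : ℕ) - 1) (n + 1)
  rw [Polynomial.descPochhammer_smeval_eq_ascPochhammer, Polynomial.ascPochhammer_smeval_cast,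
    Polynomial.ascPochhammer_smeval_eq_eval] at h
  have h2 : -a + (n + 1 : ℕ) - 1 - (n + 1 : ℕ) + 1 = -a := by ring
  rw [h2, nsmul_eq_mul] at h
  have h3 : (ascPochhammer ℝ (n + 1)).eval (-a) ≤ 0 := by
    clear h h2
    induction n with
    | zero => simp [ha.le]
    | succ n ih =>
      rw [ascPochhammer_succ_eval]
      refine mul_nonpos_of_nonpos_of_nonneg ih ?_
      push_cast
      linarith [n.cast_nonneg (α := ℝ)]
  rw [h] at h3
  exact nonpos_of_mul_nonpos_right h3 (by positivity)

theorem hasSum_one_sub_cpow (a : ℝ) (z w : 𝔻) :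
    HasSum (fun n : ℕ => ((-Ring.choose (-a + (n + 1 : ℕ) - 1) (n + 1) : ℝ) : ℂ) *
      ((z : ℂ) * conj (w : ℂ)) ^ (n + 1)) (1 - (1 - (z : ℂ) * conj (w : ℂ)) ^ (a : ℂ)) := by
  -- The kernel series at exponent `-a` expands `(1 - x)^a`; its constant term `1` is split off.
  have h := ((hasSum_nat_add_iff' 1).mpr (hasSum_kernel (-a) z w)).neg
  convert! h using 1
  · ext n
    push_cast
    ring
  · simp [Complex.cpow_neg]

/-- The conjugate monomials `z̄^(n+1)`, weighted by the square roots of the power series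
coefficients of `1 - (1 - x)^a`. -/
def discEmbeddingCoeff (a : ℝ) (z : 𝔻) (n : ℕ) : ℂ :=
  (√(-Ring.choose (-a + (n + 1 : ℕ) - 1) (n + 1)) : ℂ) * conj (z : ℂ) ^ (n + 1)

theorem conj_discEmbeddingCoeff_mul {a : ℝ} (ha : 0 < a) (ha1 : a ≤ 1) (z w : 𝔻) (n : ℕ) :
    conj (discEmbeddingCoeff a z n) * discEmbeddingCoeff a w n =
      ((-Ring.choose (-a + (n + 1 : ℕ) - 1) (n + 1) : ℝ) : ℂ) *
        ((z : ℂ) * conj (w : ℂ)) ^ (n + 1) := by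
  have h := Real.mul_self_sqrt (neg_nonneg.mpr (choose_succ_nonpos ha ha1 n))
  rw [← h, Complex.ofReal_mul]
  simp only [discEmbeddingCoeff, map_mul, map_pow, Complex.conj_conj, Complex.conj_ofReal]
  ring

theorem memℓp_discEmbeddingCoeff {a : ℝ} (ha : 0 < a) (ha1 : a ≤ 1) (z : 𝔻) :
    Memℓp (discEmbeddingCoeff a z) 2 := by
  refine memℓp_gen ((Complex.hasSum_re (hasSum_one_sub_cpow a z z)).summable.congr fun n => ?_)
  rw [← conj_discEmbeddingCoeff_mul ha ha1, ← Complex.normSq_eq_conj_mul_self, Complex.ofReal_re,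
    Complex.normSq_eq_norm_sq]
  simp

/-- The map `b : 𝔻 → ℓ²` with `⟨b z, b w⟩ = 1 - (1 - z w̄)^a` for `0 < a ≤ 1`. -/
def discEmbedding {a : ℝ} (ha : 0 < a) (ha1 : a ≤ 1) (z : 𝔻) : lp (fun _ : ℕ => ℂ) 2 :=
  ⟨discEmbeddingCoeff a z, memℓp_discEmbeddingCoeff ha ha1 z⟩

theorem inner_discEmbedding {a : ℝ} (ha : 0 < a) (ha1 : a ≤ 1) (z w : 𝔻) :
    ⟪discEmbedding ha ha1 z, discEmbedding ha ha1 w⟫_ℂ =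
      1 - (1 - (z : ℂ) * conj (w : ℂ)) ^ (a : ℂ) := by
  refine (lp.hasSum_inner _ _).unique ((hasSum_one_sub_cpow a z w).congr_fun fun n => ?_)
  rw [← conj_discEmbeddingCoeff_mul ha ha1, mul_comm]
  rfl

theorem one_sub_mul_conj_ne_zero (z w : 𝔻) : 1 - (z : ℂ) * conj (w : ℂ) ≠ 0 := by
  intro h
  have h1 : ‖(z : ℂ) * conj (w : ℂ)‖ < 1 := by
    rw [norm_mul, RCLike.norm_conj]
    exact mul_lt_one_of_nonneg_of_lt_one_left (norm_nonneg _) z.norm_lt_one w.norm_lt_one.le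
  rw [← sub_eq_zero.mp h, norm_one] at h1
  exact h1.false

theorem isCompletePickSpace_weightedSpace {a : ℝ} (ha : 0 < a) (ha1 : a ≤ 1) :
    IsCompletePickSpace (WeightedSpace a ha) := by
  refine isCompletePickSpace_of_kernel (discEmbedding ha ha1) fun z w => ?_
  rw [kernel_weightedSpace, inner_discEmbedding, sub_sub_cancel, one_div, inv_mul_cancel₀]
  rw [Complex.cpow_ne_zero_iff]
  exact Or.inl (one_sub_mul_conj_ne_zero z w)

end Sufficiency

/-! ### The case `a > 1`: holomorphy and the Schwarz lemma. -/

section Necessity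

open Metric

/-- The extension by zero to the plane of a function on the disc. -/
def extendZero (f : 𝔻 → ℂ) (z : ℂ) : ℂ :=
  if h : ‖z‖ < 1 then f (Complex.UnitDisc.mk z h) else 0

theorem extendZero_coe (f : 𝔻 → ℂ) (z : 𝔻) : extendZero f z = f z := by
  rw [extendZero, dif_pos z.norm_lt_one, Complex.UnitDisc.mk_coe]

theorem one_sub_mul_conj_mem_slitPlane {z w : ℂ} (hz : ‖z‖ < 1) (hw : ‖w‖ < 1) :
    1 - z * conj w ∈ Complex.slitPlane := by
  refine Complex.mem_slitPlane_of_norm_lt_one (z := -(z * conj w)) ?_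
  rw [norm_neg, norm_mul, RCLike.norm_conj]
  exact mul_lt_one_of_nonneg_of_lt_one_left (norm_nonneg _) hz hw.le

theorem differentiableOn_extendZero_of_mem_span {H : Type*} [NormedAddCommGroup H]
    [InnerProductSpace ℂ H] [CompleteSpace H] [RKHS ℂ H 𝔻 ℂ] {a : ℝ}
    (hk : ∀ z w : 𝔻, RKHS.kernel H z w 1 = 1 / (1 - (z : ℂ) * conj (w : ℂ)) ^ (a : ℂ)) {f : H}
    (hf : f ∈ Submodule.span ℂ {RKHS.kerFun H x v | (x) (v)}) :
    DifferentiableOn ℂ (extendZero f) (ball 0 1) := by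
  induction hf using Submodule.span_induction with
  | mem f hf =>
    obtain ⟨w, v, rfl⟩ := hf
    have h1 : DifferentiableOn ℂ
        (fun z : ℂ => 1 / (1 - z * conj (w : ℂ)) ^ (a : ℂ) * v) (ball 0 1) := by
      intro z hz
      rw [mem_ball_zero_iff] at hz
      have hs := one_sub_mul_conj_mem_slitPlane hz w.norm_lt_one
      have hb : DifferentiableAt ℂ (fun z : ℂ => 1 - z * conj (w : ℂ)) z := by fun_prop
      have hc := hb.cpow (differentiableAt_const (a : ℂ)) hs
      have hne : (1 - z * conj (w : ℂ)) ^ (a : ℂ) ≠ 0 := by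
        rw [Complex.cpow_ne_zero_iff]
        exact Or.inl (Complex.slitPlane_ne_zero hs)
      exact (((differentiableAt_const (1 : ℂ)).div hc hne).mul_const v).differentiableWithinAt
    refine h1.congr fun z hz => ?_
    rw [mem_ball_zero_iff] at hz
    have h2 := (RKHS.kernel H (Complex.UnitDisc.mk z hz) w).map_smul v 1
    rw [extendZero, dif_pos hz, RKHS.kerFun_apply]
    rw [smul_eq_mul, mul_one, hk, smul_eq_mul] at h2
    rw [h2, mul_comm]
    rfl
  | zero =>
    refine (differentiableOn_const (0 : ℂ)).congr fun z _ => ?_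
    simp [extendZero]
  | add f g _ _ hf hg =>
    refine (hf.add hg).congr fun z hz => ?_
    rw [mem_ball_zero_iff] at hz
    simp [extendZero, hz]
  | smul c f _ hf =>
    refine (hf.const_smul c).congr fun z hz => ?_
    rw [mem_ball_zero_iff] at hz
    simp [extendZero, hz]

theorem norm_kerFun_le {X H : Type*} [NormedAddCommGroup H] [InnerProductSpace ℂ H]
    [CompleteSpace H] [RKHS ℂ H X ℂ] (x : X) :
    ‖RKHS.kerFun H x‖ ≤ √‖RKHS.kernel H x x 1‖ := by
  rw [RKHS.norm_kerFun_eq_sqrt_norm_kernel]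
  refine Real.sqrt_le_sqrt (ContinuousLinearMap.opNorm_le_bound _ (norm_nonneg _) fun v => ?_)
  have h := (RKHS.kernel H x x).map_smul v 1
  rw [smul_eq_mul, mul_one] at h
  rw [h, norm_smul, mul_comm]

/-- The elements of a space with kernel `1 / (1 - z w̄)^a` are holomorphic on the disc. -/
theorem differentiableOn_extendZero {H : Type*} [NormedAddCommGroup H]
    [InnerProductSpace ℂ H] [CompleteSpace H] [RKHS ℂ H 𝔻 ℂ] {a : ℝ}
    (hk : ∀ z w : 𝔻, RKHS.kernel H z w 1 = 1 / (1 - (z : ℂ) * conj (w : ℂ)) ^ (a : ℂ)) (f : H) :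
    DifferentiableOn ℂ (extendZero f) (ball 0 1) := by
  have hf : f ∈ closure (Submodule.span ℂ
      {RKHS.kerFun H x v | (x) (v)} : Set H) := by
    rw [← Submodule.topologicalClosure_coe, RKHS.kerFun_dense]
    trivial
  obtain ⟨u, hu, hlim⟩ := mem_closure_iff_seq_limit.mp hf
  refine TendstoLocallyUniformlyOn.differentiableOn (φ := Filter.atTop)
    (F := fun n => extendZero (u n)) ?_
    (Filter.Eventually.of_forall fun n => differentiableOn_extendZero_of_mem_span hk (hu n))
    isOpen_ball
  rw [tendstoLocallyUniformlyOn_iff_forall_isCompact isOpen_ball]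
  intro K hK hKc
  have hcont : ContinuousOn (fun z : ℂ => 1 / (1 - z * conj z) ^ (a : ℂ)) K := by
    intro z hz
    have hz1 := mem_ball_zero_iff.mp (hK hz)
    have hs := one_sub_mul_conj_mem_slitPlane hz1 hz1
    have hb : ContinuousAt (fun z : ℂ => 1 - z * conj z) z :=
      (continuous_const.sub (continuous_id.mul Complex.continuous_conj)).continuousAt
    have hc := hb.cpow (continuousAt_const (y := (a : ℂ))) hs
    have hne : (1 - z * conj z) ^ (a : ℂ) ≠ 0 := by
      rw [Complex.cpow_ne_zero_iff]
      exact Or.inl (Complex.slitPlane_ne_zero hs)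
    exact (continuousAt_const.div hc hne).continuousWithinAt
  obtain ⟨C, hC⟩ := hKc.exists_bound_of_continuousOn hcont
  -- Evaluations are uniformly bounded over a compact set, so norm convergence implies uniform
  -- convergence there.
  have hunif := RKHS.tendstoUniformlyOn_of_norm_kerFun_le (H := H) (C := √C)
    (s := {z : 𝔻 | (z : ℂ) ∈ K}) (fun z hz => by
      refine (norm_kerFun_le z).trans (Real.sqrt_le_sqrt ?_)
      rw [hk]
      exact hC z hz) hlim
  rw [Metric.tendstoUniformlyOn_iff] at hunif ⊢
  intro ε hε
  filter_upwards [hunif ε hε] with n hn z hz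
  have hz1 := mem_ball_zero_iff.mp (hK hz)
  rw [extendZero, extendZero, dif_pos hz1, dif_pos hz1]
  exact hn (Complex.UnitDisc.mk z hz1) hz

/-- The kernel function at `x` is an eigenvector of `M_φ^*` with eigenvalue `conj (φ x)`. -/
theorem norm_apply_le_of_norm_mulOp_le {X H : Type*} [NormedAddCommGroup H]
    [InnerProductSpace ℂ H] [CompleteSpace H] [RKHS ℂ H X ℂ] (φ : multiplierAlgebra (X := X) H)
    (hφ : ‖mulOp φ‖ ≤ 1) {x : X} (hx : RKHS.kernel H x x 1 ≠ 0) : ‖(φ : X → ℂ) x‖ ≤ 1 := by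
  have h0 : RKHS.kerFun H x 1 ≠ 0 := by
    rintro h
    rw [← inner_kerFun_kerFun, h, inner_zero_left] at hx
    exact hx rfl
  have h1 : ContinuousLinearMap.adjoint (mulOp φ) (RKHS.kerFun H x 1) =
      conj ((φ : X → ℂ) x) • RKHS.kerFun H x 1 := by
    refine ext_inner_right ℂ fun f => ?_
    rw [ContinuousLinearMap.adjoint_inner_left, inner_smul_left, RKHS.kerFun_inner,
      RKHS.kerFun_inner, mulOp_apply]
    simp [mul_comm]
  have h2 := (ContinuousLinearMap.adjoint (mulOp φ)).le_of_opNorm_le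
    ((LinearIsometryEquiv.norm_map _ _).trans_le hφ) (RKHS.kerFun H x 1)
  rw [h1, norm_smul, RCLike.norm_conj] at h2
  exact le_of_mul_le_mul_right h2 (norm_pos_iff.mpr h0)

theorem norm_mulOp_le_norm_matrixMulOp {X H : Type*} [NormedAddCommGroup H]
    [InnerProductSpace ℂ H] [CompleteSpace H] [RKHS ℂ H X ℂ]
    (Φ : Matrix (Fin 1) (Fin 1) (multiplierAlgebra (X := X) H)) :
    ‖mulOp (Φ 0 0)‖ ≤ ‖matrixMulOp Φ‖ := by
  refine ContinuousLinearMap.opNorm_le_bound _ (norm_nonneg _) fun f => ?_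
  have h1 := (matrixMulOp Φ).le_opNorm (WithLp.toLp 2 fun _ => f)
  have h2 : matrixMulOp Φ (WithLp.toLp 2 fun _ => f) =
      WithLp.toLp 2 fun _ => mulOp (Φ 0 0) f := by
    ext i
    rw [matrixMulOp_apply, Fin.sum_univ_one, Subsingleton.elim i 0]
  rw [h2] at h1
  simpa [PiLp.norm_eq_of_L2] using h1

/-- The kernel function at `0` is the constant `1`, so `φ = φ · 1` lies in the space and is
holomorphic; the Schwarz lemma applies. -/
theorem norm_le_norm_of_contractive_multiplier {a : ℝ} (ha : 0 < a)
    (φ : multiplierAlgebra (X := 𝔻) (WeightedSpace a ha)) (hφ : ‖mulOp φ‖ ≤ 1)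
    (h0 : (φ : 𝔻 → ℂ) 0 = 0) (z : 𝔻) : ‖(φ : 𝔻 → ℂ) z‖ ≤ ‖(z : ℂ)‖ := by
  let f := mulOp φ (RKHS.kerFun (WeightedSpace a ha) 0 1)
  have h1 : ∀ w : 𝔻, extendZero f w = (φ : 𝔻 → ℂ) w := by
    intro w
    rw [extendZero_coe, mulOp_apply, RKHS.kerFun_apply, kernel_weightedSpace]
    simp
  rw [← h1]
  refine Complex.norm_le_norm_of_mapsTo_ball
    (differentiableOn_extendZero (kernel_weightedSpace a ha) f) ?_ ((h1 0).trans h0) z.norm_lt_one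
  intro w hw
  rw [mem_ball_zero_iff] at hw
  have h2 := norm_apply_le_of_norm_mulOp_le φ hφ (x := Complex.UnitDisc.mk w hw) (by
    rw [kernel_weightedSpace, one_div]
    refine inv_ne_zero ?_
    rw [Complex.cpow_ne_zero_iff]
    exact Or.inl (one_sub_mul_conj_ne_zero _ _))
  rw [← h1] at h2
  exact mem_closedBall_zero_iff.mpr h2

theorem le_one_of_isCompletePickSpace {a : ℝ} (ha : 0 < a)
    (h : IsCompletePickSpace (WeightedSpace a ha)) : a ≤ 1 := by
  by_contra! ha1
  let x : 𝔻 := Complex.UnitDisc.mk (1 / 2) (by norm_num)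
  have hx : (x : ℂ) = 1 / 2 := rfl
  have hlt : (3 / 4 : ℝ) ^ a < 3 / 4 := by
    simpa using Real.rpow_lt_rpow_of_exponent_gt (x := (3 / 4 : ℝ)) (by norm_num) (by norm_num) ha1
  have hpos : 0 < (3 / 4 : ℝ) ^ a := by positivity
  -- Chosen so that `k(x,x) (1 - t²) = 1` at `x = 1/2`: the Pick matrix for `0 ↦ 0`, `x ↦ t` is then
  -- the all-ones matrix.
  let t : ℝ := √(1 - (3 / 4 : ℝ) ^ a)
  have ht : t * t = 1 - (3 / 4 : ℝ) ^ a := Real.mul_self_sqrt (by linarith)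
  have hcpow : (3 / 4 : ℂ) ^ (a : ℂ) = (((3 / 4 : ℝ) ^ a : ℝ) : ℂ) := by
    rw [Complex.ofReal_cpow (by norm_num)]
    norm_num
  let z : Fin 2 → 𝔻 := ![0, x]
  let Λ : Fin 2 → Matrix (Fin 1) (Fin 1) ℂ := ![0, Matrix.of fun _ _ => (t : ℂ)]
  have hP : (pickMatrix (WeightedSpace a ha) z Λ).PosSemidef := by
    convert! Matrix.posSemidef_vecMulVec_self_star (fun _ : Fin 2 × Fin 1 => (1 : ℂ)) using 1
    ext ⟨i, k⟩ ⟨j, l⟩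
    rw [Subsingleton.elim k 0, Subsingleton.elim l 0]
    rw [pickMatrix, Matrix.of_apply, kernel_weightedSpace]
    fin_cases i <;> fin_cases j
    · simp [z, Λ, Matrix.vecMulVec_apply]
    · simp [z, Λ, Matrix.vecMulVec_apply]
    · simp [z, Λ, Matrix.vecMulVec_apply]
    · have h1 : (1 : ℂ) - 1 / 2 * conj (1 / 2 : ℂ) = 3 / 4 := by
        simp only [map_div₀, map_one, map_ofNat]; norm_num
      have h2 : (1 : ℂ) - t * t = (((3 / 4 : ℝ) ^ a : ℝ) : ℂ) := by
        rw [← Complex.ofReal_mul, ht]; push_cast; ring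
      have h3 : (((3 / 4 : ℝ) ^ a : ℝ) : ℂ) ≠ 0 := Complex.ofReal_ne_zero.mpr hpos.ne'
      simp only [z, Λ, Matrix.vecMulVec_apply, Fin.mk_one, Matrix.cons_val_one,
        Matrix.cons_val_fin_one, hx, h1, hcpow, Matrix.sub_apply, Matrix.one_apply_eq,
        Matrix.mul_apply, Fin.sum_univ_one, Matrix.conjTranspose_apply, Matrix.of_apply,
        RCLike.star_def, Complex.conj_ofReal, h2, Pi.star_apply, map_one, mul_one]
      exact one_div_mul_cancel h3
  obtain ⟨Φ, hΦ, hnorm⟩ := h 1 le_rfl 2 z Λ hP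
  have h0 : (Φ 0 0 : 𝔻 → ℂ) 0 = 0 := congrFun (congrFun (hΦ 0) 0) 0
  have h1 : (Φ 0 0 : 𝔻 → ℂ) x = t := congrFun (congrFun (hΦ 1) 0) 0
  have h2 := norm_le_norm_of_contractive_multiplier ha (Φ 0 0)
    ((norm_mulOp_le_norm_matrixMulOp Φ).trans hnorm) h0 x
  rw [h1, hx, Complex.norm_real, Real.norm_of_nonneg (Real.sqrt_nonneg _)] at h2
  have h3 : t ≤ 1 / 2 := h2.trans (by norm_num)
  -- From `0 ≤ t ≤ 1/2` follows `(3/4)^a = 1 - t² ≥ 3/4`, impossible for `a > 1`.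
  nlinarith [Real.sqrt_nonneg (1 - (3 / 4 : ℝ) ^ a)]

end Necessity

end CompletePick

end

theorem mainTheorem12 (a : ℝ) (ha : 0 < a) :
    CompletePick.IsCompletePickSpace (CompletePick.WeightedSpace a ha) ↔ 0 < a ∧ a ≤ 1 :=
  ⟨fun h => ⟨ha, CompletePick.le_one_of_isCompletePickSpace ha h⟩,
    fun h => CompletePick.isCompletePickSpace_weightedSpace ha h.2⟩
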